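/- Let $K$ be an abstract simplicial complex on the vertex set $[m]=\{1,\dots,m\}$ (with $\varnothing\in K$) and let $J=(j_1,\dots,j_m)$ be a sequence of positive integers; put $d(J)=j_1+\cdots+j_m$. Let $K(J)$ be the simplicial complex on the vertices $v_{ik}$ ($1\le i\le m$, $1\le k\le j_i$) whose minimal non-faces are exactly the sets $\{v_{ik}: i\in\eta,\ 1\le k\le j_i\}$, where $\eta$ runs through the minimal non-faces of $K$ (the iterated simplicial wedge of $K$). Let $D^2\subset\mathbb{C}$ be the closed unit disc with boundary $S^1$, and let $D^{2j}\subset\mathbb{C}^{j}$ be the closed Euclidean unit ball with boundary $S^{2j-1}$. Let $$Z\big(K;(\underline{D}^{2J},\underline{S}^{2J-1})\big)=\bigcup_{\sigma\in K}\Big(\prod_{i\in\sigma}D^{2j_i}\times\prod_{i\notin\sigma}S^{2j_i-1}\Big)\subset\prod_{i=1}^m\mathbb{C}^{j_i},$$ $$Z\big(K(J);(D^2,S^1)\big)=\bigcup_{\tau\in K(J)}\Big(\prod_{v\in\tau}D^2\times\prod_{v\notin\tau}S^1\Big)\subset\mathbb{C}^{d(J)}=\prod_{i=1}^m\mathbb{C}^{j_i}.$$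 The torus $T^m=(S^1)^m$ acts continuously on both spaces by letting $t_i$ multiply all coordinates of the $i$-th factor $\mathbb{C}^{j_i}$. With respect to these actions the two spaces are equivariantly diffeomorphic, up to straightening the corners of the polydiscs $(D^2)^{j_i}$. Precisely: a map between subsets of Euclidean spaces is called smooth at a point if near that point it is the restriction of a $C^\infty$ map defined on an open set. A corner of $(D^2)^{j}$ is a point with at least two coordinates of modulus $1$. Then there are $S^1$-equivariant homeomorphisms $h_i:(D^2)^{j_i}\to D^{2j_i}$, smooth everywhere and with inverse smooth outside the image of the corners, such that the product $h_1\times\cdots\times h_m$ restricts to a $T^m$-equivariant homeomorphism $$\Phi: Z\big(K(J);(D^2,S^1)\big)\longrightarrow Z\big(K;(\underline{D}^{2J},\underline{S}^{2J-1})\big)$$ which is smooth everywhere, and whose inverse is smooth at $\Phi(z)$ for every $z$ none of whose blocks $(z_{i1},\dots,z_{ij_i})$ is a corner of $(D^2)^{j_i}$. In particular, for $J=(1,\dots,1)$ the map $\Phi$ is a diffeomorphism. -/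

import Mathlib

open scoped ContDiff

namespace MomentAngle

/-! ### Simplicial complexes

Mathlib's `PreAbstractSimplicialComplex ι` is a downward closed family of nonempty finite subsets of
`ι`. The empty simplex, which belongs to every complex by convention, is not listed among the faces,
and `ι` may contain elements that are not vertices of the complex. -/

/-- `τ` is a simplex of `K`: a listed face or the empty simplex. -/
def IsSimplex {ι : Type*} (K : PreAbstractSimplicialComplex ι) (τ : Finset ι) : Prop :=
  τ = ∅ ∨ τ ∈ K

/-- `τ` is a minimal non-face of `K`: it is not a simplex of `K`, but all its proper subsets are. -/
def IsMinimalNonface {ι : Type*} (K : PreAbstractSimplicialComplex ι) (τ : Finset ι) : Prop :=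
  ¬ IsSimplex K τ ∧ ∀ ρ, ρ ⊂ τ → IsSimplex K ρ

/-- The vertices `v_{ik}`, `1 ≤ i ≤ m`, `1 ≤ k ≤ j_i`, of the complex `K(J)`. -/
abbrev Vertex {m : ℕ} (J : Fin m → ℕ) : Type := Σ i : Fin m, Fin (J i)

/-- The set of all `v_{ik}` with `i ∈ η`. -/
def blocks {m : ℕ} (J : Fin m → ℕ) (η : Finset (Fin m)) : Finset (Vertex J) :=
  η.sigma fun _ => Finset.univ

/-- The complex `K(J)` whose minimal non-faces are exactly the sets `blocks J η`, where `η` runs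
through the minimal non-faces of `K`: its simplices are the sets that contain none of these. -/
def wedge {m : ℕ} (K : PreAbstractSimplicialComplex (Fin m)) (J : Fin m → ℕ) :
    PreAbstractSimplicialComplex (Vertex J) where
  faces := {τ | τ.Nonempty ∧ ∀ η, IsMinimalNonface K η → ¬ blocks J η ⊆ τ}
  isRelLowerSet_faces := by
    intro τ hτ
    exact ⟨hτ.1, fun ρ hρ hne => ⟨hne, fun η hη h => hτ.2 η hη (h.trans hρ)⟩⟩

theorem IsSimplex.mono {ι : Type*} {K : PreAbstractSimplicialComplex ι} {σ τ : Finset ι}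
    (h : IsSimplex K τ) (hσ : σ ⊆ τ) : IsSimplex K σ := by
  rcases Finset.eq_empty_or_nonempty σ with h0 | h0
  · exact Or.inl h0
  · rcases h with rfl | h
    · exact Or.inl (Finset.subset_empty.mp hσ)
    · exact Or.inr ((K.isRelLowerSet_faces h).2 hσ h0)

theorem isSimplex_wedge_iff {m : ℕ} (K : PreAbstractSimplicialComplex (Fin m)) {J : Fin m → ℕ}
    (hJ : ∀ i, 0 < J i) (τ : Finset (Vertex J)) :
    IsSimplex (wedge K J) τ ↔ ∀ η, IsMinimalNonface K η → ¬ blocks J η ⊆ τ := by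
  constructor
  · rintro (rfl | h) η hη hsub
    · have hne : η.Nonempty := by
        rw [Finset.nonempty_iff_ne_empty]
        exact fun h => hη.1 (Or.inl h)
      obtain ⟨i, hi⟩ := hne
      have : (⟨i, ⟨0, hJ i⟩⟩ : Vertex J) ∈ blocks J η := by simp [blocks, hi]
      exact absurd (hsub this) (by simp)
    · exact h.2 η hη hsub
  · intro h
    rcases Finset.eq_empty_or_nonempty τ with h0 | h0
    · exact Or.inl h0
    · exact Or.inr ⟨h0, h⟩

/-- The defining property of `K(J)`. -/
theorem isMinimalNonface_wedge_iff {m : ℕ} (K : PreAbstractSimplicialComplex (Fin m))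
    {J : Fin m → ℕ} (hJ : ∀ i, 0 < J i) (τ : Finset (Vertex J)) :
    IsMinimalNonface (wedge K J) τ ↔ ∃ η, IsMinimalNonface K η ∧ τ = blocks J η := by
  constructor
  · rintro ⟨h1, h2⟩
    rw [isSimplex_wedge_iff K hJ] at h1
    push Not at h1
    obtain ⟨η, hη, hsub⟩ := h1
    refine ⟨η, hη, ?_⟩
    by_contra hne
    have := h2 _ (hsub.ssubset_of_ne (Ne.symm hne))
    exact (isSimplex_wedge_iff K hJ _).1 this η hη subset_rfl
  · rintro ⟨η, hη, rfl⟩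
    refine ⟨fun h => (isSimplex_wedge_iff K hJ _).1 h η hη subset_rfl, fun ρ hρ => ?_⟩
    rw [isSimplex_wedge_iff K hJ]
    intro η' hη' hsub
    have hle : η' ⊆ η := by
      intro i hi
      have : (⟨i, ⟨0, hJ i⟩⟩ : Vertex J) ∈ blocks J η := hρ.1 (hsub (by simp [blocks, hi]))
      simpa [blocks] using this
    rcases hle.eq_or_ssubset with rfl | hlt
    · exact hρ.2 hsub
    · exact hη'.1 (hη.2 _ hlt)

/-! ### Polyhedral products -/

/-- The polyhedral product `Z(K; (X, A))`, for pairs of subsets `A i ⊆ X i ⊆ E i`: the union over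
the simplices `σ` of `K` (the empty one included) of the products `∏ W i`, where `W i = X i` for
`i ∈ σ` and `W i = A i` for `i ∉ σ`. -/
def polyhedralProduct {ι : Type*} {E : ι → Type*} (K : PreAbstractSimplicialComplex ι)
    (X A : ∀ i, Set (E i)) : Set (∀ i, E i) :=
  {z | ∃ σ, IsSimplex K σ ∧ ∀ i, (i ∈ σ → z i ∈ X i) ∧ (i ∉ σ → z i ∈ A i)}

/-- `Z(K(J); (D², S¹))`, a subset of `ℂ^{d(J)}`. -/
def momentAngleComplex {m : ℕ} (K : PreAbstractSimplicialComplex (Fin m)) (J : Fin m → ℕ) :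
    Set (Vertex J → ℂ) :=
  polyhedralProduct (wedge K J) (fun _ => Metric.closedBall (0 : ℂ) 1)
    (fun _ => Metric.sphere (0 : ℂ) 1)

/-- `Z(K; (D^{2J}, S^{2J-1}))`, where `D^{2j}` is the closed Euclidean unit ball of `ℂ^j` and
`S^{2j-1}` the unit sphere, a subset of `∏ ℂ^{j_i}`. -/
def genMomentAngleComplex {m : ℕ} (K : PreAbstractSimplicialComplex (Fin m)) (J : Fin m → ℕ) :
    Set (∀ i, EuclideanSpace ℂ (Fin (J i))) :=
  polyhedralProduct K (fun i => Metric.closedBall (0 : EuclideanSpace ℂ (Fin (J i))) 1)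
    (fun i => Metric.sphere (0 : EuclideanSpace ℂ (Fin (J i))) 1)

/-- The polydisc `(D²)^j` in `ℂ^j`. -/
def polydisc (j : ℕ) : Set (Fin j → ℂ) := {z | ∀ k, ‖z k‖ ≤ 1}

/-- The block `(z_{i1}, …, z_{ij_i})` of a point of `Z(K(J); (D², S¹))`. -/
def block {m : ℕ} {K : PreAbstractSimplicialComplex (Fin m)} {J : Fin m → ℕ}
    (z : momentAngleComplex K J) (i : Fin m) : polydisc (J i) :=
  ⟨fun k => z.1 ⟨i, k⟩, fun k => by
    obtain ⟨σ, -, h⟩ := z.2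
    by_cases hk : (⟨i, k⟩ : Vertex J) ∈ σ
    · simpa using (h ⟨i, k⟩).1 hk
    · have := (h ⟨i, k⟩).2 hk
      simp only [mem_sphere_iff_norm, sub_zero] at this
      exact this.le⟩

/-! ### Smooth maps between subsets of normed spaces, and corners -/

section Smooth

variable {E F : Type*} [NormedAddCommGroup E] [NormedSpace ℝ E] [NormedAddCommGroup F]
  [NormedSpace ℝ F]

/-- A map `f : X → Y` between subsets of normed spaces is smooth at `x` if, near `x`, it is the
restriction of a `C^∞` map defined on an open subset of the ambient space. -/
def SmoothMapAt {X : Set E} {Y : Set F} (f : X → Y) (x : X) : Prop :=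
  ∃ U : Set E, IsOpen U ∧ (x : E) ∈ U ∧ ∃ f' : E → F, ContDiffOn ℝ ∞ f' U ∧
    ∀ x' : X, (x' : E) ∈ U → f' x' = f x'

/-- A homeomorphism `f` that is smooth everywhere, and whose inverse is smooth at the image of every
point that does not lie in the set `C` of corners. -/
def IsDiffeoOffCorners {X : Set E} {Y : Set F} (f : X ≃ₜ Y) (C : Set E) : Prop :=
  (∀ x, SmoothMapAt f x) ∧ ∀ x : X, (x : E) ∉ C → SmoothMapAt f.symm (f x)

end Smooth

/-- The corners of the polydisc: at least two coordinates have modulus one. -/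
def polydiscCorners (j : ℕ) : Set (Fin j → ℂ) :=
  {z | ∃ k l, k ≠ l ∧ ‖z k‖ = 1 ∧ ‖z l‖ = 1}

/-- The points of `ℂ^{d(J)}` one of whose blocks is a corner of the polydisc `(D²)^{j_i}`. -/
def blockCorners {m : ℕ} (J : Fin m → ℕ) : Set (Vertex J → ℂ) :=
  {z | ∃ i, (fun k => z ⟨i, k⟩) ∈ polydiscCorners (J i)}

/-- A diffeomorphism `(D²)^j → D^{2j}` that straightens the corners of the polydisc. -/
def IsStraightening {j : ℕ}
    (h : polydisc j ≃ₜ Metric.closedBall (0 : EuclideanSpace ℂ (Fin j)) 1) : Prop :=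
  IsDiffeoOffCorners h (polydiscCorners j)

end MomentAngle

namespace MomentAngle

open Set Filter Topology

/-! ### Inverses of smooth maps -/

section Inverse

variable {E F : Type*} [NormedAddCommGroup E] [NormedSpace ℝ E] [NormedAddCommGroup F]
  [NormedSpace ℝ F]

/-! Write `N = ∑ |z_k|²` and `P = ∏ (1 - |z_k|²)`. On the polydisc `z ↦ z / √(N + P)` has squared
norm `N / (N + P)`, which is at most 1, with equality exactly when `P = 0`, that is, on the
boundary. The map is radial and sees only moduli outside the direction of `z`, so it commutes with
the circle; monotonicity of `P` along rays gives injectivity, the intermediate value theorem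
surjectivity.

It is analytic near the polydisc, and its derivative can degenerate only in the radial direction.
There its size is governed by `P + ∑_k |z_k|² ∏_{l ≠ k} (1 - |z_l|²)`, which is positive on the
polydisc away from the corners (`boundaryDefect_add_sum_pos`); the inverse function theorem then
makes the inverse smooth.

For the complexes, a point of a polyhedral product of balls and spheres is tested on the set of its
interior coordinates (`mem_polyhedralProduct_ball_sphere_iff`). A straightened block is interior
exactly when all its coordinates are, and `τ` is a simplex of `K(J)` exactly when the blocks wholly
contained in `τ` form a simplex of `K` (`isSimplex_wedge_iff_isSimplex`). Hence the product of the
straightenings matches the two complexes. -/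

theorem smoothMapAt_of_contDiffAt {X : Set E} {Y : Set F} {f : X → Y} {x : X} {f' : E → F}
    (hf' : ContDiffAt ℝ ω f' x) (h : ∀ x' : X, f' x' = f x') : SmoothMapAt f x := by
  -- Analyticity at a point spreads to a neighbourhood. Being `C^∞` at a point in the sense of
  -- `ContDiffAt` only gives, for each finite order, a neighbourhood depending on that order; hence
  -- `ω` in the hypothesis.
  obtain ⟨U, hU, hUo, hxU⟩ := eventually_nhds_iff.1 (hf'.eventually (by decide))
  exact ⟨U, hUo, hxU, f', fun y hy => ((hU y hy).of_le le_top).contDiffWithinAt, fun x' _ => h x'⟩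

/-- The inverse of a homeomorphism between subsets is smooth wherever the homeomorphism extends
to an analytic map with invertible derivative. -/
theorem smoothMapAt_symm_of_hasFDerivAt [CompleteSpace E] {X : Set E} {Y : Set F} (f : X ≃ₜ Y)
    {x : X} {f' : E → F} (hf' : ContDiffAt ℝ ω f' x) (h : ∀ x' : X, f' x' = f x') {A : E ≃L[ℝ] F}
    (hA : HasFDerivAt f' (A : E →L[ℝ] F) x) : SmoothMapAt f.symm (f x) := by
  have hω : (ω : WithTop ℕ∞) ≠ 0 := by decide
  set e := hf'.toOpenPartialHomeomorph f' hA hω with he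
  have hsymm : ContDiffAt ℝ ω e.symm (f x) := h x ▸ hf'.to_localInverse hA hω
  obtain ⟨V, hV, hVo, hxV⟩ := eventually_nhds_iff.1 (hsymm.eventually (by decide))
  -- The local inverse agrees with `f.symm` only where `f.symm` lands in the source of `e`.
  -- Continuity of `f.symm` makes this relatively open, so it is cut out by an ambient open set `O`.
  have hO : IsOpen ((fun y : Y => (f.symm y : E)) ⁻¹' e.source) :=
    e.open_source.preimage (continuous_subtype_val.comp f.symm.continuous)
  obtain ⟨O, hOo, hOeq⟩ := isOpen_induced_iff.1 hO
  have hmem : ∀ y : Y, (y : F) ∈ O ↔ (f.symm y : E) ∈ e.source := fun y => Set.ext_iff.1 hOeq y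
  refine ⟨V ∩ O, hVo.inter hOo, ⟨hxV, (hmem _).2 ?_⟩, e.symm,
    fun y hy => ((hV y hy.1).of_le le_top).contDiffWithinAt, fun y hy => ?_⟩
  · rw [f.symm_apply_apply]
    exact hf'.mem_toOpenPartialHomeomorph_source hA hω
  · have h1 : e (f.symm y) = y := by
      rw [he, ContDiffAt.toOpenPartialHomeomorph_coe, h, f.apply_symm_apply]
    rw [← e.left_inv ((hmem y).1 hy.2), h1]

/-- A radial map `x ↦ c x • x` has invertible derivative wherever neither `c` nor its derivative in
the radial direction vanishes. -/
theorem exists_hasFDerivAt_smul_self [FiniteDimensional ℝ E] {c : E → ℝ} {c' : E →L[ℝ] ℝ} {z : E}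
    (hc : HasFDerivAt c c' z) (h0 : c z ≠ 0) (h1 : c z + c' z ≠ 0) :
    ∃ A : E ≃L[ℝ] E, HasFDerivAt (fun x => c x • x) (A : E →L[ℝ] E) z := by
  set B : E →L[ℝ] E := c z • ContinuousLinearMap.id ℝ E + c'.smulRight z with hB
  have hBv : ∀ v, B v = c z • v + c' v • z := fun v => rfl
  have hder : HasFDerivAt (fun x => c x • x) B z := hc.smul (hasFDerivAt_id z)
  have hinj : Function.Injective (B : E →ₗ[ℝ] E) := by
    rw [injective_iff_map_eq_zero]
    intro v hv
    replace hv : c z • v + c' v • z = 0 := hv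
    -- A kernel vector is a multiple of `z`; applying `c'` to that relation gives `c' v * (c z + c'
    -- z) = 0`.
    have hv' : v = (-((c z)⁻¹ * c' v)) • z := by
      have : (c z)⁻¹ • (c z • v + c' v • z) = 0 := by rw [hv, smul_zero]
      rw [smul_add, smul_smul, smul_smul, inv_mul_cancel₀ h0, one_smul] at this
      rw [neg_smul]
      exact eq_neg_of_add_eq_zero_left this
    have hl : c' v = 0 := by
      have := congrArg c' hv'
      rw [map_smul, smul_eq_mul] at this
      have h2 : c' v * (c z + c' z) = 0 := by
        field_simp at this
        linarith
      exact (mul_eq_zero.1 h2).resolve_right h1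
    rw [hv', hl, mul_zero, neg_zero, zero_smul]
  refine ⟨(LinearEquiv.ofInjectiveEndo (B : E →ₗ[ℝ] E) hinj).toContinuousLinearEquiv, ?_⟩
  convert! hder

end Inverse

/-! ### The straightening map -/

section Straightening

variable {j : ℕ}

/-- The product of the numbers `1 - |z_k|²`; on the polydisc it vanishes exactly on the boundary. -/
noncomputable def boundaryDefect (z : Fin j → ℂ) : ℝ := ∏ k, (1 - ‖z k‖ ^ 2)

/-- The factor by which the straightening map divides `z`. -/
noncomputable def radialFactor (z : Fin j → ℂ) : ℝ := √(∑ k, ‖z k‖ ^ 2 + boundaryDefect z)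

/-- The straightening map `z ↦ z / √(|z|² + ∏ (1 - |z_k|²))`. -/
noncomputable def straighten (z : Fin j → ℂ) : EuclideanSpace ℂ (Fin j) :=
  WithLp.toLp 2 ((radialFactor z)⁻¹ • z)

theorem boundaryDefect_nonneg {z : Fin j → ℂ} (hz : z ∈ polydisc j) : 0 ≤ boundaryDefect z :=
  Finset.prod_nonneg fun k _ => by nlinarith [hz k, norm_nonneg (z k)]

theorem boundaryDefect_pos {z : Fin j → ℂ} (hz : ∀ k, ‖z k‖ < 1) : 0 < boundaryDefect z :=
  Finset.prod_pos fun k _ => by nlinarith [hz k, norm_nonneg (z k)]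

theorem boundaryDefect_eq_zero_iff {z : Fin j → ℂ} : boundaryDefect z = 0 ↔ ∃ k, ‖z k‖ = 1 := by
  simp only [boundaryDefect, Finset.prod_eq_zero_iff, Finset.mem_univ, true_and, sub_eq_zero]
  refine exists_congr fun k => ?_
  rw [eq_comm, pow_eq_one_iff_of_nonneg (norm_nonneg _) two_ne_zero]

theorem boundaryDefect_pos_iff {z : Fin j → ℂ} (hz : z ∈ polydisc j) :
    0 < boundaryDefect z ↔ ∀ k, ‖z k‖ < 1 := by
  refine ⟨fun h k => (hz k).lt_of_ne fun hk => h.ne' ?_, boundaryDefect_pos⟩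
  exact boundaryDefect_eq_zero_iff.2 ⟨k, hk⟩

/-- If the product vanishes, some coordinate has modulus one and the sum is at least 1. -/
theorem radicand_pos {z : Fin j → ℂ} (hz : z ∈ polydisc j) :
    0 < ∑ k, ‖z k‖ ^ 2 + boundaryDefect z := by
  have h0 : 0 ≤ ∑ k, ‖z k‖ ^ 2 := Finset.sum_nonneg fun k _ => sq_nonneg _
  rcases (boundaryDefect_nonneg hz).eq_or_lt with h | h
  · obtain ⟨k, hk⟩ := boundaryDefect_eq_zero_iff.1 h.symm
    have : ‖z k‖ ^ 2 ≤ ∑ k, ‖z k‖ ^ 2 :=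
      Finset.single_le_sum (f := fun k => ‖z k‖ ^ 2) (fun k _ => sq_nonneg _) (Finset.mem_univ k)
    rw [hk] at this
    linarith
  · linarith

theorem radialFactor_pos {z : Fin j → ℂ} (hz : z ∈ polydisc j) : 0 < radialFactor z :=
  Real.sqrt_pos.2 (radicand_pos hz)

theorem norm_sq_straighten {z : Fin j → ℂ} (hz : z ∈ polydisc j) :
    ‖straighten z‖ ^ 2 = (∑ k, ‖z k‖ ^ 2) / (∑ k, ‖z k‖ ^ 2 + boundaryDefect z) := by
  have h : ∀ k, ‖straighten z k‖ ^ 2 = ‖z k‖ ^ 2 / (∑ k, ‖z k‖ ^ 2 + boundaryDefect z) := by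
    intro k
    have : straighten z k = (radialFactor z)⁻¹ • z k := rfl
    rw [this, norm_smul, mul_pow, norm_inv, inv_pow, Real.norm_eq_abs, sq_abs, radialFactor,
      Real.sq_sqrt (radicand_pos hz).le, inv_mul_eq_div]
  rw [EuclideanSpace.norm_sq_eq, Finset.sum_congr rfl fun k _ => h k, Finset.sum_div]

theorem norm_straighten_le {z : Fin j → ℂ} (hz : z ∈ polydisc j) : ‖straighten z‖ ≤ 1 := by
  rw [← sq_le_one_iff₀ (norm_nonneg _), norm_sq_straighten hz, div_le_one (radicand_pos hz)]
  linarith [boundaryDefect_nonneg hz]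

theorem norm_straighten_lt_iff {z : Fin j → ℂ} (hz : z ∈ polydisc j) :
    ‖straighten z‖ < 1 ↔ ∀ k, ‖z k‖ < 1 := by
  rw [← boundaryDefect_pos_iff hz, ← sq_lt_one_iff₀ (norm_nonneg _), norm_sq_straighten hz,
    div_lt_one (radicand_pos hz), lt_add_iff_pos_right]

theorem radialFactor_eq_of_norm_eq {z z' : Fin j → ℂ} (h : ∀ k, ‖z' k‖ = ‖z k‖) :
    radialFactor z' = radialFactor z := by
  simp [radialFactor, boundaryDefect, h]

/-- The radial factor depends only on the moduli. Relating two points by a hypothesis serves both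
the polydisc and the blocks of a torus translate. -/
theorem straighten_circle_smul (c : Circle) {z z' : Fin j → ℂ} (h : ∀ k, z' k = (c : ℂ) * z k) :
    straighten z' = (c : ℂ) • straighten z := by
  ext k
  have hr : radialFactor z' = radialFactor z := radialFactor_eq_of_norm_eq fun k => by
    rw [h, norm_mul, Circle.norm_coe, one_mul]
  change (radialFactor z')⁻¹ • z' k = (c : ℂ) * ((radialFactor z)⁻¹ • z k)
  rw [hr, h, mul_smul_comm]

theorem contDiffAt_inv_radialFactor {z : Fin j → ℂ} (hz : z ∈ polydisc j) :
    ContDiffAt ℝ ω (fun z : Fin j → ℂ => (radialFactor z)⁻¹) z := by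
  have hk : ∀ k, ContDiff ℝ ω fun z : Fin j → ℂ => ‖z k‖ ^ 2 := fun k =>
    (contDiff_apply ℝ ℂ k).norm_sq ℝ
  have hQ : ContDiff ℝ ω fun z : Fin j → ℂ => ∑ k, ‖z k‖ ^ 2 + boundaryDefect z :=
    (ContDiff.sum fun k _ => hk k).add (contDiff_prod fun k _ => contDiff_const.sub (hk k))
  exact (hQ.contDiffAt.sqrt (radicand_pos hz).ne').inv (radialFactor_pos hz).ne'

theorem contDiffAt_straighten {z : Fin j → ℂ} (hz : z ∈ polydisc j) :
    ContDiffAt ℝ ω (straighten (j := j)) z :=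
  (PiLp.continuousLinearEquiv 2 ℝ fun _ : Fin j => ℂ).symm.contDiff.contDiffAt.comp z
    ((contDiffAt_inv_radialFactor hz).smul contDiffAt_id)

/-- The radial derivative of the scalar factor of the straightening map. -/
theorem hasDerivAt_inv_radialFactor_smul {z : Fin j → ℂ} (hz : z ∈ polydisc j) :
    HasDerivAt (fun t : ℝ => (radialFactor (t • z))⁻¹)
      (-(∑ k, ‖z k‖ ^ 2 - ∑ k, (∏ l ∈ Finset.univ.erase k, (1 - ‖z l‖ ^ 2)) * ‖z k‖ ^ 2) /
        radialFactor z ^ 3) 1 := by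
  have hk : ∀ k, HasDerivAt (fun t : ℝ => ‖(t • z) k‖ ^ 2) (2 * ‖z k‖ ^ 2) 1 := by
    intro k
    have h1 : (fun t : ℝ => ‖(t • z) k‖ ^ 2) = fun t => t ^ 2 * ‖z k‖ ^ 2 := by
      ext t
      rw [Pi.smul_apply, norm_smul, mul_pow, Real.norm_eq_abs, sq_abs]
    rw [h1]
    simpa using (hasDerivAt_pow 2 (1 : ℝ)).mul_const (‖z k‖ ^ 2)
  have hQ : HasDerivAt (fun t : ℝ => ∑ k, ‖(t • z) k‖ ^ 2 + boundaryDefect (t • z))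
      (∑ k, 2 * ‖z k‖ ^ 2 +
        ∑ k, (∏ l ∈ Finset.univ.erase k, (1 - ‖z l‖ ^ 2)) * -(2 * ‖z k‖ ^ 2)) 1 := by
    refine (HasDerivAt.fun_sum fun k _ => hk k).add ?_
    have := HasDerivAt.fun_finsetProd (u := Finset.univ) fun k _ => (hk k).const_sub 1
    simpa [boundaryDefect] using this
  have hpos := radialFactor_pos hz
  have h1 : radialFactor ((1 : ℝ) • z) = radialFactor z := by rw [one_smul]
  have hs := hQ.sqrt (by rw [one_smul]; exact (radicand_pos hz).ne')
  have hi := hs.fun_inv (by change radialFactor _ ≠ 0; rw [h1]; exact hpos.ne')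
  refine hi.congr_deriv ?_
  change -(_ / (2 * radialFactor ((1 : ℝ) • z))) / radialFactor ((1 : ℝ) • z) ^ 2 = _
  rw [h1]
  have e1 : ∑ k, (∏ l ∈ Finset.univ.erase k, (1 - ‖z l‖ ^ 2)) * -(2 * ‖z k‖ ^ 2) =
      -2 * ∑ k, (∏ l ∈ Finset.univ.erase k, (1 - ‖z l‖ ^ 2)) * ‖z k‖ ^ 2 := by
    rw [Finset.mul_sum]
    exact Finset.sum_congr rfl fun k _ => by ring
  rw [e1, ← Finset.mul_sum]
  field_simp
  ring

/-- At a boundary point that is not a corner exactly one coordinate has modulus one, and its summand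
is a product of positive factors. At a corner every term has a vanishing factor. -/
theorem boundaryDefect_add_sum_pos {z : Fin j → ℂ} (hz : z ∈ polydisc j)
    (hc : z ∉ polydiscCorners j) :
    0 < boundaryDefect z + ∑ k, (∏ l ∈ Finset.univ.erase k, (1 - ‖z l‖ ^ 2)) * ‖z k‖ ^ 2 := by
  have hnn : ∀ k, 0 ≤ (∏ l ∈ Finset.univ.erase k, (1 - ‖z l‖ ^ 2)) * ‖z k‖ ^ 2 := fun k =>
    mul_nonneg (Finset.prod_nonneg fun l _ => by nlinarith [hz l, norm_nonneg (z l)]) (sq_nonneg _)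
  rcases (boundaryDefect_nonneg hz).eq_or_lt with h | h
  · obtain ⟨k, hk⟩ := boundaryDefect_eq_zero_iff.1 h.symm
    have hlt : ∀ l, l ≠ k → ‖z l‖ < 1 := fun l hl =>
      (hz l).lt_of_ne fun h' => hc ⟨l, k, hl, h', hk⟩
    have hpos : 0 < (∏ l ∈ Finset.univ.erase k, (1 - ‖z l‖ ^ 2)) * ‖z k‖ ^ 2 := by
      rw [hk, one_pow, mul_one]
      refine Finset.prod_pos fun l hl => ?_
      nlinarith [hlt l (Finset.ne_of_mem_erase hl), norm_nonneg (z l)]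
    rw [← h, zero_add]
    exact Finset.sum_pos' (fun k _ => hnn k) ⟨k, Finset.mem_univ k, hpos⟩
  · exact add_pos_of_pos_of_nonneg h (Finset.sum_nonneg fun k _ => hnn k)

theorem exists_hasFDerivAt_straighten {z : Fin j → ℂ} (hz : z ∈ polydisc j)
    (hc : z ∉ polydiscCorners j) :
    ∃ A : (Fin j → ℂ) ≃L[ℝ] EuclideanSpace ℂ (Fin j),
      HasFDerivAt straighten (A : (Fin j → ℂ) →L[ℝ] EuclideanSpace ℂ (Fin j)) z := by
  have hd := ((contDiffAt_inv_radialFactor hz).differentiableAt (by decide)).hasFDerivAt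
  have hpos := radialFactor_pos hz
  set c' := fderiv ℝ (fun z : Fin j → ℂ => (radialFactor z)⁻¹) z
  -- `c' z` is the derivative of the scalar factor along the ray `t ↦ t • z` at `t = 1`.
  have hrad : c' z = -(∑ k, ‖z k‖ ^ 2 -
      ∑ k, (∏ l ∈ Finset.univ.erase k, (1 - ‖z l‖ ^ 2)) * ‖z k‖ ^ 2) / radialFactor z ^ 3 := by
    refine HasDerivAt.unique ?_ (hasDerivAt_inv_radialFactor_smul hz)
    have hl : HasDerivAt (fun t : ℝ => t • z) z 1 := by
      simpa using (hasDerivAt_id (1 : ℝ)).smul_const z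
    exact HasFDerivAt.comp_hasDerivAt (1 : ℝ) (by rwa [one_smul]) hl
  have hsq : radialFactor z ^ 2 = ∑ k, ‖z k‖ ^ 2 + boundaryDefect z :=
    Real.sq_sqrt (radicand_pos hz).le
  obtain ⟨A, hA⟩ := exists_hasFDerivAt_smul_self hd (inv_ne_zero hpos.ne') (by
    have e : (radialFactor z)⁻¹ = radialFactor z ^ 2 / radialFactor z ^ 3 := by field_simp
    rw [hrad, e, hsq, ← add_div]
    refine (div_pos ?_ (pow_pos hpos 3)).ne'
    linarith [boundaryDefect_add_sum_pos hz hc])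
  let e := (PiLp.continuousLinearEquiv 2 ℝ fun _ : Fin j => ℂ).symm
  exact ⟨A.trans e, e.hasFDerivAt.comp z hA⟩

/-- Points with equal images satisfy `z = s • w`, with `s ≤ 1` after a swap. If `s < 1`, then `z` is
interior, so `P(z) > 0`, and equality of the images forces `P(z) = s² P(w)`. But `P(w) ≤ P(z)`, a
contradiction. -/
theorem straighten_injOn : InjOn (straighten (j := j)) (polydisc j) := by
  have key : ∀ {z w : Fin j → ℂ}, z ∈ polydisc j → w ∈ polydisc j →
      straighten z = straighten w → radialFactor z ≤ radialFactor w → z = w := by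
    intro z w hz hw h hle
    have hpz := radialFactor_pos hz
    have hpw := radialFactor_pos hw
    set s := radialFactor z / radialFactor w with hs
    have hs0 : 0 ≤ s := (div_pos hpz hpw).le
    have hzk : ∀ k, z k = s • w k := by
      intro k
      have hk : (radialFactor z)⁻¹ • z k = (radialFactor w)⁻¹ • w k :=
        congrArg (fun v : EuclideanSpace ℂ (Fin j) => v k) h
      rw [hs, div_eq_mul_inv, mul_smul, ← hk, smul_inv_smul₀ hpz.ne']
    rcases (show s ≤ 1 from (div_le_one hpw).2 hle).eq_or_lt with h1 | h1
    · funext k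
      rw [hzk, h1, one_smul]
    have hnk : ∀ k, ‖z k‖ = s * ‖w k‖ := fun k => by
      rw [hzk, norm_smul, Real.norm_of_nonneg hs0]
    have hlt : ∀ k, ‖z k‖ < 1 := fun k => by
      rw [hnk]
      nlinarith [hw k, norm_nonneg (w k)]
    have hdef : boundaryDefect w ≤ boundaryDefect z := by
      refine Finset.prod_le_prod (fun k _ => by nlinarith [hw k, norm_nonneg (w k)]) fun k _ => ?_
      have : ‖z k‖ ≤ ‖w k‖ := by
        rw [hnk]
        nlinarith [norm_nonneg (w k)]
      nlinarith [norm_nonneg (z k), norm_nonneg (w k)]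
    have hN : ∑ k, ‖z k‖ ^ 2 = s ^ 2 * ∑ k, ‖w k‖ ^ 2 := by
      rw [Finset.mul_sum]
      exact Finset.sum_congr rfl fun k _ => by rw [hnk, mul_pow]
    have hsq : ∑ k, ‖z k‖ ^ 2 + boundaryDefect z =
        s ^ 2 * (∑ k, ‖w k‖ ^ 2 + boundaryDefect w) := by
      rw [← Real.sq_sqrt (radicand_pos hz).le, ← Real.sq_sqrt (radicand_pos hw).le, ← mul_pow]
      change radialFactor z ^ 2 = (s * radialFactor w) ^ 2
      rw [hs, div_mul_cancel₀ _ hpw.ne']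
    have hd := boundaryDefect_pos hlt
    have hs2 : s ^ 2 < 1 := by nlinarith
    have h2 : boundaryDefect z = s ^ 2 * boundaryDefect w := by linarith
    nlinarith [boundaryDefect_nonneg hw]
  intro z hz w hw h
  rcases le_total (radialFactor z) (radialFactor w) with hle | hle
  · exact key hz hw h hle
  · exact (key hw hz h.symm hle).symm

theorem exists_straighten_eq {w : EuclideanSpace ℂ (Fin j)} (hw : ‖w‖ ≤ 1) :
    ∃ z ∈ polydisc j, straighten z = w := by
  rcases eq_or_ne w 0 with rfl | hw0
  · exact ⟨0, fun k => by simp, by ext k; simp [straighten]⟩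
  set v : Fin j → ℂ := WithLp.ofLp w with hv
  have hv0 : 0 < ‖v‖ := norm_pos_iff.2 fun h => hw0 (by ext k; exact congrFun h k)
  have hN : ∑ k, ‖v k‖ ^ 2 ≤ 1 := by
    rw [hv, ← EuclideanSpace.norm_sq_eq]
    nlinarith [norm_nonneg w]
  have hsum : ∀ t : ℝ, ∑ k, ‖(t • v) k‖ ^ 2 = t ^ 2 * ∑ k, ‖v k‖ ^ 2 := fun t => by
    rw [Finset.mul_sum]
    refine Finset.sum_congr rfl fun k _ => ?_
    rw [Pi.smul_apply, norm_smul, mul_pow, Real.norm_eq_abs, sq_abs]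
  -- At a zero `t ≥ 0` of this function the radicand at `t • v` equals `t²`, so `t • v` is sent to
  -- `v`. It is `-1` at `t = 0` and nonnegative where the ray leaves the polydisc, at `t = ‖v‖⁻¹`;
  -- here `‖v‖` is the sup norm.
  have hcont : Continuous fun t : ℝ => t ^ 2 * (1 - ∑ k, ‖v k‖ ^ 2) - boundaryDefect (t • v) := by
    unfold boundaryDefect
    fun_prop
  have hend : boundaryDefect (‖v‖⁻¹ • v) = 0 := by
    have : Nonempty (Fin j) := by
      by_contra h
      rw [not_nonempty_iff] at h
      exact hv0.ne' (by rw [Subsingleton.elim v 0, norm_zero])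
    obtain ⟨k, hmax⟩ := Finite.exists_max fun k => ‖v k‖
    have hk : ‖v k‖ = ‖v‖ :=
      (norm_le_pi_norm v k).antisymm ((pi_norm_le_iff_of_nonneg (norm_nonneg _)).2 hmax)
    refine boundaryDefect_eq_zero_iff.2 ⟨k, ?_⟩
    rw [Pi.smul_apply, norm_smul, hk, norm_inv, norm_norm, inv_mul_cancel₀ hv0.ne']
  obtain ⟨t, ⟨ht0, ht1⟩, ht⟩ := intermediate_value_Icc (inv_nonneg.2 hv0.le) hcont.continuousOn
    (show (0 : ℝ) ∈ Icc _ _ by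
      refine ⟨?_, ?_⟩
      · simp [boundaryDefect]
      · simp only [hend, sub_zero]
        exact mul_nonneg (sq_nonneg _) (by linarith))
  replace ht : t ^ 2 * (1 - ∑ k, ‖v k‖ ^ 2) - boundaryDefect (t • v) = 0 := ht
  have hmem : t • v ∈ polydisc j := fun k => by
    rw [Pi.smul_apply, norm_smul, Real.norm_of_nonneg ht0]
    calc t * ‖v k‖ ≤ ‖v‖⁻¹ * ‖v‖ := by gcongr; exact norm_le_pi_norm v k
      _ = 1 := inv_mul_cancel₀ hv0.ne'
  have hrt : radialFactor (t • v) = t := by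
    rw [radialFactor, hsum, show t ^ 2 * ∑ k, ‖v k‖ ^ 2 + boundaryDefect (t • v) = t ^ 2 by linarith,
      Real.sqrt_sq ht0]
  have htpos : t ≠ 0 := hrt ▸ (radialFactor_pos hmem).ne'
  exact ⟨t • v, hmem, by rw [straighten, hrt, inv_smul_smul₀ htpos]⟩

theorem isCompact_polydisc (j : ℕ) : IsCompact (polydisc j) := by
  have : polydisc j = Set.pi univ fun _ => Metric.closedBall (0 : ℂ) 1 := by
    ext z
    simp [polydisc]
  rw [this]
  exact isCompact_univ_pi fun _ => isCompact_closedBall 0 1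

/-- The straightening map as a bijection from the polydisc to the ball. -/
noncomputable def straightenEquiv (j : ℕ) :
    polydisc j ≃ Metric.closedBall (0 : EuclideanSpace ℂ (Fin j)) 1 :=
  Equiv.ofBijective
    (fun z => ⟨straighten z.1, mem_closedBall_zero_iff.2 (norm_straighten_le z.2)⟩)
    ⟨fun z w h => Subtype.ext (straighten_injOn z.2 w.2 (congrArg Subtype.val h)), fun w => by
      obtain ⟨z, hz, h⟩ := exists_straighten_eq (mem_closedBall_zero_iff.1 w.2)
      exact ⟨⟨z, hz⟩, Subtype.ext h⟩⟩

theorem continuous_straightenEquiv (j : ℕ) : Continuous (straightenEquiv j) :=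
  Continuous.subtype_mk (continuous_iff_continuousAt.2 fun z =>
    (contDiffAt_straighten z.2).continuousAt.comp continuousAt_subtype_val) _

/-- The straightening map as a homeomorphism from the polydisc to the ball. -/
noncomputable def straightenHomeomorph (j : ℕ) :
    polydisc j ≃ₜ Metric.closedBall (0 : EuclideanSpace ℂ (Fin j)) 1 :=
  -- Compactness yields continuity of the inverse even at the corners, where the inverse function
  -- theorem does not apply.
  haveI : CompactSpace (polydisc j) := isCompact_iff_compactSpace.1 (isCompact_polydisc j)
  (continuous_straightenEquiv j).homeoOfEquivCompactToT2

theorem isStraightening_straightenHomeomorph (j : ℕ) :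
    IsStraightening (straightenHomeomorph j) := by
  refine ⟨fun z => smoothMapAt_of_contDiffAt (contDiffAt_straighten z.2) fun _ => rfl,
    fun z hz => ?_⟩
  obtain ⟨A, hA⟩ := exists_hasFDerivAt_straighten z.2 hz
  exact smoothMapAt_symm_of_hasFDerivAt _ (contDiffAt_straighten z.2) (fun _ => rfl) hA

end Straightening

/-! ### Simplices in terms of minimal non-faces -/

theorem exists_isMinimalNonface_subset {ι : Type*} {K : PreAbstractSimplicialComplex ι}
    {σ : Finset ι} (h : ¬ IsSimplex K σ) : ∃ η ⊆ σ, IsMinimalNonface K η := by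
  classical
  induction σ using Finset.strongInduction with
  | H σ ih =>
    by_cases hmin : ∀ ρ, ρ ⊂ σ → IsSimplex K ρ
    · exact ⟨σ, subset_rfl, h, hmin⟩
    · push Not at hmin
      obtain ⟨ρ, hρ, hns⟩ := hmin
      obtain ⟨η, hη, hmn⟩ := ih ρ hρ hns
      exact ⟨η, hη.trans hρ.1, hmn⟩

/-- This puts `K` in the same form as `isSimplex_wedge_iff`, so that the two complexes can be
compared one minimal non-face at a time. -/
theorem isSimplex_iff {ι : Type*} {K : PreAbstractSimplicialComplex ι} {σ : Finset ι} :
    IsSimplex K σ ↔ ∀ η, IsMinimalNonface K η → ¬ η ⊆ σ := by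
  refine ⟨fun h η hη hsub => hη.1 (h.mono hsub), fun h => ?_⟩
  by_contra hns
  obtain ⟨η, hη, hmn⟩ := exists_isMinimalNonface_subset hns
  exact h η hmn hη

/-- A set `τ` is a simplex of `K(J)` if and only if the vertices of `K` whose block lies in `τ` form
a simplex of `K`. -/
theorem isSimplex_wedge_iff_isSimplex {m : ℕ} (K : PreAbstractSimplicialComplex (Fin m))
    {J : Fin m → ℕ} (hJ : ∀ i, 0 < J i) {τ : Finset (Vertex J)} {σ : Finset (Fin m)}
    (h : ∀ i, i ∈ σ ↔ ∀ k, (⟨i, k⟩ : Vertex J) ∈ τ) :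
    IsSimplex (wedge K J) τ ↔ IsSimplex K σ := by
  rw [isSimplex_wedge_iff K hJ, isSimplex_iff]
  refine forall_congr' fun η => imp_congr_right fun _ => not_congr ?_
  simp only [blocks, Finset.subset_iff, Finset.mem_sigma, Finset.mem_univ, and_true, h, Sigma.forall]
  exact ⟨fun H i hi k => H i k hi, fun H i k hi => H hi k⟩

/-! ### The points of polyhedral products of balls and spheres -/

section Polyhedral

variable {ι : Type*} {E : ι → Type*} [∀ i, NormedAddCommGroup (E i)]

/-- Any simplex witnessing membership must contain all interior coordinates, so by downward closure
the set of these is the smallest possible witness. -/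
theorem mem_polyhedralProduct_ball_sphere_iff (K : PreAbstractSimplicialComplex ι)
    {z : ∀ i, E i} {σ : Finset ι} (hσ : ∀ i, i ∈ σ ↔ ‖z i‖ < 1) :
    z ∈ polyhedralProduct K (fun i => Metric.closedBall (0 : E i) 1)
        (fun i => Metric.sphere (0 : E i) 1) ↔
      (∀ i, ‖z i‖ ≤ 1) ∧ IsSimplex K σ := by
  simp only [polyhedralProduct, mem_ofPred_eq, mem_closedBall_zero_iff, mem_sphere_zero_iff_norm]
  constructor
  · rintro ⟨τ, hτ, h⟩
    refine ⟨fun i => ?_, hτ.mono fun i hi => ?_⟩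
    · by_cases hi : i ∈ τ
      · exact (h i).1 hi
      · exact ((h i).2 hi).le
    · by_contra hiτ
      exact ((hσ i).1 hi).ne ((h i).2 hiτ)
  · rintro ⟨h1, h2⟩
    exact ⟨σ, h2, fun i => ⟨fun _ => h1 i, fun hi =>
      (h1 i).antisymm (not_lt.1 fun h => hi ((hσ i).2 h))⟩⟩

theorem mem_polyhedralProduct_of_norm_eq {K : PreAbstractSimplicialComplex ι} {z w : ∀ i, E i}
    (h : ∀ i, ‖w i‖ = ‖z i‖)
    (hz : z ∈ polyhedralProduct K (fun i => Metric.closedBall (0 : E i) 1)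
      (fun i => Metric.sphere (0 : E i) 1)) :
    w ∈ polyhedralProduct K (fun i => Metric.closedBall (0 : E i) 1)
      (fun i => Metric.sphere (0 : E i) 1) := by
  obtain ⟨σ, hσ, H⟩ := hz
  refine ⟨σ, hσ, fun i => ?_⟩
  simpa only [mem_closedBall_zero_iff, mem_sphere_zero_iff_norm, h] using H i

end Polyhedral

variable {m : ℕ} {K : PreAbstractSimplicialComplex (Fin m)} {J : Fin m → ℕ}

/-- A product of maps of polydiscs to balls that take exactly the boundary to the boundary sends
`Z(K(J); (D², S¹))`, and only this set, to `Z(K; (D^{2J}, S^{2J-1}))`. -/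
theorem mem_momentAngleComplex_iff (hJ : ∀ i, 0 < J i) {z : Vertex J → ℂ}
    {w : ∀ i, EuclideanSpace ℂ (Fin (J i))}
    (hle : (∀ i, ‖w i‖ ≤ 1) ↔ ∀ v, ‖z v‖ ≤ 1) (hlt : ∀ i, ‖w i‖ < 1 ↔ ∀ k, ‖z ⟨i, k⟩‖ < 1) :
    z ∈ momentAngleComplex K J ↔ w ∈ genMomentAngleComplex K J := by
  classical
  rw [momentAngleComplex, genMomentAngleComplex,
    mem_polyhedralProduct_ball_sphere_iff (σ := {v | ‖z v‖ < 1}) _ (by simp),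
    mem_polyhedralProduct_ball_sphere_iff (σ := {i | ‖w i‖ < 1}) _ (by simp), hle,
    isSimplex_wedge_iff_isSimplex K hJ (σ := {i | ‖w i‖ < 1}) (by simp [hlt])]

theorem norm_le_one_of_mem_genMomentAngleComplex {w : ∀ i, EuclideanSpace ℂ (Fin (J i))}
    (hw : w ∈ genMomentAngleComplex K J) (i : Fin m) : ‖w i‖ ≤ 1 := by
  classical
  exact ((mem_polyhedralProduct_ball_sphere_iff (σ := {i | ‖w i‖ < 1}) _ (by simp)).1 hw).1 i

/-! ### The torus actions -/

/-- The coordinatewise action of the torus on `Z(K(J); (D², S¹))`. -/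
noncomputable abbrev momentAngleAction (K : PreAbstractSimplicialComplex (Fin m)) (J : Fin m → ℕ) :
    MulAction (Fin m → Circle) (momentAngleComplex K J) where
  smul t z := ⟨fun v => (t v.1 : ℂ) * z.1 v, mem_polyhedralProduct_of_norm_eq
    (fun v => by rw [norm_mul, Circle.norm_coe, one_mul]) z.2⟩
  one_smul z := Subtype.ext (funext fun v => one_mul (z.1 v))
  mul_smul s t z := Subtype.ext (funext fun v => by
    change ((s v.1 * t v.1 : Circle) : ℂ) * z.1 v = s v.1 * (t v.1 * z.1 v)
    rw [Circle.coe_mul, mul_assoc])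

/-- The coordinatewise action of the torus on `Z(K; (D^{2J}, S^{2J-1}))`. -/
noncomputable abbrev genMomentAngleAction (K : PreAbstractSimplicialComplex (Fin m))
    (J : Fin m → ℕ) : MulAction (Fin m → Circle) (genMomentAngleComplex K J) where
  smul t w := ⟨fun i => (t i : ℂ) • w.1 i, mem_polyhedralProduct_of_norm_eq
    (fun i => by rw [norm_smul, Circle.norm_coe, one_mul]) w.2⟩
  one_smul w := Subtype.ext (funext fun i => one_smul ℂ (w.1 i))
  mul_smul s t w := Subtype.ext (funext fun i => by
    change ((s i * t i : Circle) : ℂ) • w.1 i = (s i : ℂ) • (t i : ℂ) • w.1 i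
    rw [Circle.coe_mul, mul_smul])

/-! ### The product of the straightening maps -/

theorem norm_straightenHomeomorph_lt_iff {j : ℕ} (z : polydisc j) :
    ‖(straightenHomeomorph j z).1‖ < 1 ↔ ∀ k, ‖z.1 k‖ < 1 :=
  norm_straighten_lt_iff z.2

theorem continuous_block (i : Fin m) :
    Continuous fun z : momentAngleComplex K J => block z i := by
  refine continuous_induced_rng.2 (continuous_pi fun k => ?_)
  exact (continuous_apply (⟨i, k⟩ : Vertex J)).comp continuous_subtype_val

/-- The factors of a point of `Z(K; (D^{2J}, S^{2J-1}))`. -/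
def ballFactor (w : genMomentAngleComplex K J) (i : Fin m) :
    Metric.closedBall (0 : EuclideanSpace ℂ (Fin (J i))) 1 :=
  ⟨w.1 i, mem_closedBall_zero_iff.2 (norm_le_one_of_mem_genMomentAngleComplex w.2 i)⟩

theorem continuous_ballFactor (i : Fin m) :
    Continuous fun w : genMomentAngleComplex K J => ballFactor w i :=
  Continuous.subtype_mk ((continuous_apply i).comp continuous_subtype_val) _

/-- The product of the straightening maps, as a homeomorphism between the two complexes. -/
noncomputable def straightenComplex (K : PreAbstractSimplicialComplex (Fin m))
    (hJ : ∀ i, 0 < J i) : momentAngleComplex K J ≃ₜ genMomentAngleComplex K J where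
  toFun z := ⟨fun i => (straightenHomeomorph (J i) (block z i)).1,
    (mem_momentAngleComplex_iff hJ
      (iff_of_true (fun i => mem_closedBall_zero_iff.1 (straightenHomeomorph (J i) (block z i)).2)
        fun v => (block z v.1).2 v.2)
      fun i => norm_straightenHomeomorph_lt_iff (block z i)).1 z.2⟩
  invFun w := ⟨fun v => ((straightenHomeomorph (J v.1)).symm (ballFactor w v.1)).1 v.2,
    (mem_momentAngleComplex_iff hJ
      (iff_of_true (norm_le_one_of_mem_genMomentAngleComplex w.2)
        fun v => ((straightenHomeomorph (J v.1)).symm (ballFactor w v.1)).2 v.2)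
      fun i => by
        have := norm_straightenHomeomorph_lt_iff
          ((straightenHomeomorph (J i)).symm (ballFactor w i))
        rwa [Homeomorph.apply_symm_apply] at this).2 w.2⟩
  left_inv z := Subtype.ext (funext fun v =>
    congrArg (fun y : polydisc (J v.1) => y.1 v.2)
      ((straightenHomeomorph (J v.1)).symm_apply_apply (block z v.1)))
  right_inv w := Subtype.ext (funext fun i =>
    congrArg Subtype.val ((straightenHomeomorph (J i)).apply_symm_apply (ballFactor w i)))
  continuous_toFun := Continuous.subtype_mk (continuous_pi fun i => continuous_subtype_val.comp
    ((straightenHomeomorph (J i)).continuous.comp (continuous_block i))) _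
  continuous_invFun := Continuous.subtype_mk (continuous_pi fun v : Vertex J =>
    (continuous_apply v.2).comp (continuous_subtype_val.comp
      ((straightenHomeomorph (J v.1)).symm.continuous.comp (continuous_ballFactor v.1)))) _

theorem isDiffeoOffCorners_straightenComplex (hJ : ∀ i, 0 < J i) :
    IsDiffeoOffCorners (straightenComplex K hJ) (blockCorners J) := by
  constructor
  · intro z
    -- Each block has its own smooth extension. Their product, on the intersection of the preimages
    -- of the finitely many domains, extends the whole map.
    choose U hUo hzU f hf hfeq using fun i =>
      (isStraightening_straightenHomeomorph (J i)).1 (block z i)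
    have hproj : ∀ i, ContDiff ℝ ∞ fun (x : Vertex J → ℂ) (k : Fin (J i)) => x ⟨i, k⟩ :=
      fun i => contDiff_pi.2 fun k => contDiff_apply ℝ ℂ (⟨i, k⟩ : Vertex J)
    refine ⟨⋂ i, (fun (x : Vertex J → ℂ) (k : Fin (J i)) => x ⟨i, k⟩) ⁻¹' U i,
      isOpen_iInter_of_finite fun i => (hUo i).preimage (hproj i).continuous,
      mem_iInter.2 fun i => hzU i, fun x i => f i fun k => x ⟨i, k⟩,
      contDiffOn_pi.2 fun i => (hf i).comp (hproj i).contDiffOn fun x hx => mem_iInter.1 hx i,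
      fun x hx => funext fun i => hfeq i (block x i) (mem_iInter.1 hx i)⟩
  · intro z hz
    choose U hUo hzU f hf hfeq using fun i =>
      (isStraightening_straightenHomeomorph (J i)).2 (block z i) fun h => hz ⟨i, h⟩
    have hproj : ∀ i, ContDiff ℝ ∞ fun w : ∀ i, EuclideanSpace ℂ (Fin (J i)) => w i :=
      contDiff_pi.1 contDiff_id
    refine ⟨⋂ i, (fun w : ∀ i, EuclideanSpace ℂ (Fin (J i)) => w i) ⁻¹' U i,
      isOpen_iInter_of_finite fun i => (hUo i).preimage (continuous_apply i),
      mem_iInter.2 fun i => hzU i, fun w v => f v.1 (w v.1) v.2,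
      contDiffOn_pi.2 fun v => (contDiff_apply ℝ ℂ v.2).comp_contDiffOn
        ((hf v.1).comp (hproj v.1).contDiffOn fun x hx => mem_iInter.1 hx v.1),
      fun w hw => funext fun v => congrFun (hfeq v.1 (ballFactor w v.1) (mem_iInter.1 hw v.1)) v.2⟩

end MomentAngle

theorem theoremA (m : ℕ) (K : PreAbstractSimplicialComplex (Fin m)) (J : Fin m → ℕ)
    (hJ : ∀ i, 0 < J i) :
    ∃ (_ : MulAction (Fin m → Circle) (MomentAngle.momentAngleComplex K J))
      (_ : MulAction (Fin m → Circle) (MomentAngle.genMomentAngleComplex K J)),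
      -- the actions are the coordinatewise ones, and they are continuous
      (∀ (t : Fin m → Circle) (z : MomentAngle.momentAngleComplex K J) (v : MomentAngle.Vertex J),
        (t • z).1 v = (t v.1 : ℂ) * z.1 v) ∧
      (∀ (t : Fin m → Circle) (w : MomentAngle.genMomentAngleComplex K J) (i : Fin m),
        (t • w).1 i = (t i : ℂ) • w.1 i) ∧
      ContinuousSMul (Fin m → Circle) (MomentAngle.momentAngleComplex K J) ∧
      ContinuousSMul (Fin m → Circle) (MomentAngle.genMomentAngleComplex K J) ∧
      -- circle-equivariant diffeomorphisms of the factors, up to straightening corners,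
      ∃ h : ∀ i, MomentAngle.polydisc (J i) ≃ₜ
          Metric.closedBall (0 : EuclideanSpace ℂ (Fin (J i))) 1,
        (∀ i, MomentAngle.IsStraightening (h i)) ∧
        (∀ (i : Fin m) (c : Circle) (z z' : MomentAngle.polydisc (J i)),
          (∀ k, z'.1 k = (c : ℂ) * z.1 k) → (h i z').1 = (c : ℂ) • (h i z).1) ∧
        -- whose product restricts to an equivariant diffeomorphism of the two complexes
        ∃ Φ : MomentAngle.momentAngleComplex K J ≃ₜ MomentAngle.genMomentAngleComplex K J,
          (∀ z i, (Φ z).1 i = (h i (MomentAngle.block z i)).1) ∧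
          (∀ (t : Fin m → Circle) (z : MomentAngle.momentAngleComplex K J),
            Φ (t • z) = t • Φ z) ∧
          MomentAngle.IsDiffeoOffCorners Φ (MomentAngle.blockCorners J) := by
  let _ := MomentAngle.momentAngleAction K J
  let _ := MomentAngle.genMomentAngleAction K J
  refine ⟨inferInstance, inferInstance, fun _ _ _ => rfl, fun _ _ _ => rfl, ⟨?_⟩, ⟨?_⟩,
    fun i => MomentAngle.straightenHomeomorph (J i),
    fun i => MomentAngle.isStraightening_straightenHomeomorph (J i),
    fun i c z z' h => MomentAngle.straighten_circle_smul c h,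
    MomentAngle.straightenComplex K hJ, fun _ _ => rfl,
    fun t z => Subtype.ext (funext fun i => MomentAngle.straighten_circle_smul (t i) fun _ => rfl),
    MomentAngle.isDiffeoOffCorners_straightenComplex hJ⟩
  · refine continuous_induced_rng.2 (continuous_pi fun v => Continuous.mul ?_ ?_)
    · exact continuous_induced_dom.comp ((continuous_apply v.1).comp continuous_fst)
    · exact (continuous_apply v).comp (continuous_subtype_val.comp continuous_snd)
  · refine continuous_induced_rng.2 (continuous_pi fun i => Continuous.smul
      (f := fun p : (Fin m → Circle) × MomentAngle.genMomentAngleComplex K J => (p.1 i : ℂ))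
      (g := fun p => p.2.1 i) ?_ ?_)
    · exact continuous_induced_dom.comp ((continuous_apply i).comp continuous_fst)
    · exact (continuous_apply i).comp (continuous_subtype_val.comp continuous_snd)
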